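/- \textbf{Definitions.} An \emph{additively idempotent semifield} is a commutative semiring $(S,+,\cdot,0,1)$ with $0\neq 1$ in which every nonzero element is invertible and $x+x=x$ for all $x$; morphisms are semiring homomorphisms (preserving $+,\cdot,0,1$). For such $S$ let $\mathrm{Detrop}(S)$ be the abelian $\ell$-group $(S\setminus\{0\},\cdot,1)$ ordered by $x\le y\iff x+y=y$; a morphism is sent to its restriction. Morphisms of abelian $\ell$-groups are group homomorphisms preserving $\wedge$ and $\vee$. An \emph{MV-algebra} is a structure $(A,\oplus,\neg,0,1)$ such that $(A,\oplus,0)$ is a commutative monoid, $\neg 0=1$, $x\oplus 1=1$, $\neg\neg x=x$ and $\neg(\neg x\oplus y)\oplus y=\neg(\neg y\oplus x)\oplus x$; it is a lattice under $x\le y\iff\exists z\;(y=x\oplus z)$, and $x\odot y=\neg(\neg x\oplus\neg y)$. An element $x$ is \emph{infinitesimal} if $nx\le\neg x$ for all integers $n\ge 1$. $A$ is \emph{perfect} if it is the disjoint union of its set $\mathrm{Rad}(A)$ of infinitesimals and the set of negations of infinitesimals. Let $PERF$ be the category of perfect MV-algebras and MV-homomorphisms. For an abelian $\ell$-group $G$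 let $\Delta(G)\in PERF$ be the interval $[(0,0),(1,0)]$ of the lexicographic product $\mathbb Z\times_{\mathrm{lex}}G$, with $x\oplus y=(x+y)\wedge(1,0)$ and $\neg x=(1,0)-x$; a homomorphism $f$ is sent to $(n,g)\mapsto(n,f(g))$. Let $TOP$ be the category whose objects are the lattice-ordered commutative monoids with top isomorphic to $G^+\cup\{\top\}$ for some abelian $\ell$-group $G$, where $G^+=\{g\in G: g\ge 0\}$ and $\top$ is an adjoined greatest element with $\top+x=\top$ for all $x$. The elements other than $\top$ form the positive cone of the object. Morphisms are the maps preserving $+$, $0$, $\wedge$, $\vee$, mapping the positive cone into the positive cone, and mapping $\top$ to $\top$. For $A\in PERF$ let $\theta(A)=\{x\in A: x\ge 2x^2\}$, where $x^2=x\odot x$ and $2y=y\oplus y$, with the operations $\oplus,0,\wedge,\vee$ and the top element $1$ inherited from $A$; this is an object of $TOP$, and $\theta$ sends an MV-homomorphism to its restriction. \textbf{Theorem.} The composite functor $\mathbf F(S)=\theta(\Delta(\mathrm{Detrop}(S)))$ is an equivalence of categories from the category of additively idempotent semifields to $TOP$. -/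

import Mathlib

open CategoryTheory

universe u

/-! ## Additively idempotent semifields -/

/-- The category of additively idempotent semifields; its morphisms are the homomorphisms of
semirings (preserving `+`, `*`, `0` and `1`). -/
structure IdemSemifield : Type (u + 1) where
  carrier : Type u
  [semifield : Semifield carrier]
  add_self : ∀ x : carrier, x + x = x

namespace IdemSemifield

instance : CoeSort IdemSemifield.{u} (Type u) := ⟨carrier⟩

attribute [instance] semifield

instance : Category IdemSemifield.{u} where
  Hom S T := S →+* T
  id S := RingHom.id S
  comp f g := g.comp f

end IdemSemifield

/-! ## Abelian lattice-ordered groups -/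

/-- The category of abelian lattice-ordered groups. -/
structure AbLatGroup : Type (u + 1) where
  carrier : Type u
  [addCommGroup : AddCommGroup carrier]
  [lattice : Lattice carrier]
  [isOrderedAddMonoid : IsOrderedAddMonoid carrier]

/-- Homomorphisms of abelian lattice-ordered groups: group homomorphisms that preserve binary
suprema and infima. -/
@[ext]
structure LatGroupHom (G H : Type*) [AddCommGroup G] [Lattice G] [AddCommGroup H] [Lattice H]
    extends G →+ H where
  map_sup' : ∀ x y : G, toFun (x ⊔ y) = toFun x ⊔ toFun y
  map_inf' : ∀ x y : G, toFun (x ⊓ y) = toFun x ⊓ toFun y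

namespace LatGroupHom

variable {G H K : Type*} [AddCommGroup G] [Lattice G] [AddCommGroup H] [Lattice H]
  [AddCommGroup K] [Lattice K]

instance : FunLike (LatGroupHom G H) G H where
  coe f := f.toFun
  coe_injective _ _ h := LatGroupHom.ext h

protected theorem map_zero (f : LatGroupHom G H) : f 0 = 0 := f.map_zero'
protected theorem map_add (f : LatGroupHom G H) (x y : G) : f (x + y) = f x + f y := f.map_add' x y
protected theorem map_sub (f : LatGroupHom G H) (x y : G) : f (x - y) = f x - f y :=
  f.toAddMonoidHom.map_sub x y
protected theorem map_sup (f : LatGroupHom G H) (x y : G) : f (x ⊔ y) = f x ⊔ f y := f.map_sup' x y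
protected theorem map_inf (f : LatGroupHom G H) (x y : G) : f (x ⊓ y) = f x ⊓ f y := f.map_inf' x y

protected theorem monotone (f : LatGroupHom G H) {x y : G} (h : x ≤ y) : f x ≤ f y := by
  have := f.map_sup x y
  rw [sup_eq_right.2 h] at this
  exact sup_eq_right.1 this.symm

/-- The identity homomorphism. -/
def id (G : Type*) [AddCommGroup G] [Lattice G] : LatGroupHom G G where
  __ := AddMonoidHom.id G
  map_sup' _ _ := rfl
  map_inf' _ _ := rfl

/-- Composition of homomorphisms. -/
def comp (g : LatGroupHom H K) (f : LatGroupHom G H) : LatGroupHom G K where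
  __ := g.toAddMonoidHom.comp f.toAddMonoidHom
  map_sup' x y := (congrArg g (f.map_sup x y)).trans (g.map_sup _ _)
  map_inf' x y := (congrArg g (f.map_inf x y)).trans (g.map_inf _ _)

end LatGroupHom

namespace AbLatGroup

instance : CoeSort AbLatGroup.{u} (Type u) := ⟨carrier⟩

attribute [instance] addCommGroup lattice isOrderedAddMonoid

instance : Category AbLatGroup.{u} where
  Hom G H := LatGroupHom G H
  id G := LatGroupHom.id G
  comp f g := g.comp f

end AbLatGroup

/-! ## The functor `Detrop`: removing the zero of an idempotent semifield -/

/-- The nonzero elements of `S`, written additively: `x + y` is the product of `S`, and the order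
is the natural one, `x ≤ y ↔ x + y = y` in `S`. -/
@[ext]
structure Detrop (S : Type u) [Semifield S] : Type u where
  val : S
  ne_zero : val ≠ 0

namespace Detrop

section Group

variable {S : Type u} [Semifield S]

instance : Zero (Detrop S) := ⟨⟨1, one_ne_zero⟩⟩
instance : Add (Detrop S) := ⟨fun x y => ⟨x.val * y.val, mul_ne_zero x.ne_zero y.ne_zero⟩⟩
instance : Neg (Detrop S) := ⟨fun x => ⟨x.val⁻¹, inv_ne_zero x.ne_zero⟩⟩

instance : AddCommGroup (Detrop S) where
  add_assoc _ _ _ := Detrop.ext (mul_assoc _ _ _)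
  zero_add _ := Detrop.ext (one_mul _)
  add_zero _ := Detrop.ext (mul_one _)
  neg_add_cancel x := Detrop.ext (inv_mul_cancel₀ x.ne_zero)
  add_comm _ _ := Detrop.ext (mul_comm _ _)
  nsmul := nsmulRec
  zsmul := zsmulRec

theorem add_val (x y : Detrop S) : (x + y).val = x.val * y.val := rfl
theorem zero_val : (0 : Detrop S).val = 1 := rfl
theorem neg_val (x : Detrop S) : (-x).val = x.val⁻¹ := rfl

end Group

variable (S : IdemSemifield.{u})

theorem add_ne_zero {a b : S} (ha : a ≠ 0) : a + b ≠ 0 := by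
  intro h
  apply ha
  calc a = a + (a + b) := by rw [h, add_zero]
    _ = 0 := by rw [← add_assoc, S.add_self, h]

theorem inv_add_eq {a b : S} (ha : a ≠ 0) (hb : b ≠ 0) (h : a + b = b) :
    b⁻¹ + a⁻¹ = a⁻¹ := by
  have h1 : a⁻¹ = a⁻¹ * b⁻¹ * (a + b) := by rw [h, mul_assoc, inv_mul_cancel₀ hb, mul_one]
  have h2 : a⁻¹ * b⁻¹ * (a + b) = b⁻¹ + a⁻¹ := by field_simp
  rw [← h2, ← h1]

instance : Lattice (Detrop S) where
  le x y := x.val + y.val = y.val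
  le_refl x := S.add_self x.val
  le_trans x y z (hxy : _ = _) (hyz : _ = _) := by
    rw [← hyz, ← add_assoc, hxy]
  le_antisymm x y (hxy : _ = _) (hyx : _ = _) := by
    apply Detrop.ext
    rw [← hxy, add_comm, hyx]
  sup x y := ⟨x.val + y.val, add_ne_zero S x.ne_zero⟩
  inf x y := ⟨(x.val⁻¹ + y.val⁻¹)⁻¹, inv_ne_zero (add_ne_zero S (inv_ne_zero x.ne_zero))⟩
  le_sup_left x y := by
    change x.val + (x.val + y.val) = x.val + y.val
    rw [← add_assoc, S.add_self]
  le_sup_right x y := by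
    change y.val + (x.val + y.val) = x.val + y.val
    rw [add_left_comm, S.add_self]
  sup_le x y z (hxz : _ = _) (hyz : _ = _) := by
    change x.val + y.val + z.val = z.val
    rw [add_assoc, hyz, hxz]
  inf_le_left x y := by
    have := inv_add_eq S (a := x.val⁻¹) (b := x.val⁻¹ + y.val⁻¹) (inv_ne_zero x.ne_zero)
      (add_ne_zero S (inv_ne_zero x.ne_zero)) (by rw [← add_assoc, S.add_self])
    rwa [inv_inv] at this
  inf_le_right x y := by
    have := inv_add_eq S (a := y.val⁻¹) (b := x.val⁻¹ + y.val⁻¹) (inv_ne_zero y.ne_zero)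
      (add_ne_zero S (inv_ne_zero x.ne_zero)) (by rw [add_left_comm, S.add_self])
    rwa [inv_inv] at this
  le_inf x y z hxy hxz := by
    have h1 := inv_add_eq S x.ne_zero y.ne_zero hxy
    have h2 := inv_add_eq S x.ne_zero z.ne_zero hxz
    have := inv_add_eq S (a := y.val⁻¹ + z.val⁻¹) (b := x.val⁻¹)
      (add_ne_zero S (inv_ne_zero y.ne_zero)) (inv_ne_zero x.ne_zero)
      (by rw [add_assoc, h2, h1])
    rwa [inv_inv] at this

theorem sup_val (x y : Detrop S) : (x ⊔ y).val = x.val + y.val := rfl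
theorem inf_val (x y : Detrop S) : (x ⊓ y).val = (x.val⁻¹ + y.val⁻¹)⁻¹ := rfl

instance : IsOrderedAddMonoid (Detrop S) where
  add_le_add_left x y (h : _ = _) z := by
    change x.val * z.val + y.val * z.val = y.val * z.val
    rw [← add_mul, h]

/-- A homomorphism of semifields restricts to the nonzero elements. -/
def map {S T : IdemSemifield.{u}} (f : S →+* T) : LatGroupHom (Detrop S) (Detrop T) where
  toFun x := ⟨f x.val, (map_ne_zero f).2 x.ne_zero⟩
  map_zero' := Detrop.ext (map_one f)
  map_add' x y := Detrop.ext (map_mul f _ _)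
  map_sup' x y := Detrop.ext (map_add f _ _)
  map_inf' x y := Detrop.ext (by simp [inf_val])

end Detrop

/-- The functor removing the zero of an additively idempotent semifield. -/
def detropFunctor : IdemSemifield.{u} ⥤ AbLatGroup.{u} where
  obj S := { carrier := Detrop S }
  map f := Detrop.map f

/-! ## MV-algebras

The sum `x ⊕ y` of an MV-algebra is written `x + y` and the negation `¬ x` is written `xᶜ`. -/

/-- MV-algebras. -/
class MVAlgebra (A : Type*) extends AddCommMonoid A, One A, Compl A where
  compl_zero' : (0 : A)ᶜ = 1
  add_one' : ∀ x : A, x + 1 = 1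
  compl_compl' : ∀ x : A, xᶜᶜ = x
  luk' : ∀ x y : A, (xᶜ + y)ᶜ + y = (yᶜ + x)ᶜ + x

namespace MVAlgebra

variable {A : Type*} [MVAlgebra A]

/-- The product of an MV-algebra. -/
def odot (x y : A) : A := (xᶜ + yᶜ)ᶜ

end MVAlgebra

infixl:70 " ⊙ " => MVAlgebra.odot

namespace MVAlgebra

variable {A : Type*} [MVAlgebra A]

theorem cc (x : A) : xᶜᶜ = x := compl_compl' x

theorem compl_inj' {x y : A} (h : xᶜ = yᶜ) : x = y := by rw [← cc x, h, cc]

theorem one_compl : (1 : A)ᶜ = 0 := by rw [← compl_zero', cc]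

theorem compl_add (x : A) : xᶜ + x = 1 := by
  have := luk' (1 : A) x
  rw [one_compl, zero_add, add_one'] at this
  exact this

instance : LE A := ⟨fun x y => ∃ z, y = x + z⟩

theorem le_def {x y : A} : x ≤ y ↔ ∃ z, y = x + z := Iff.rfl

theorem le_iff {x y : A} : x ≤ y ↔ xᶜ + y = 1 := by
  constructor
  · rintro ⟨z, rfl⟩
    rw [← add_assoc, compl_add, add_comm, add_one']
  · intro h
    refine ⟨(yᶜ + x)ᶜ, ?_⟩
    have := luk' x y
    rw [h, one_compl, zero_add] at this
    rw [add_comm]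
    exact this

theorem le_add (x y : A) : x ≤ x + y := ⟨y, rfl⟩

theorem le_trans_mv {x y z : A} (h : x ≤ y) (h' : y ≤ z) : x ≤ z := by
  obtain ⟨a, rfl⟩ := h
  obtain ⟨b, rfl⟩ := h'
  exact ⟨a + b, add_assoc _ _ _⟩

theorem add_mono {x y : A} (h : x ≤ y) (z : A) : x + z ≤ y + z := by
  obtain ⟨a, rfl⟩ := h
  exact ⟨a, add_right_comm _ _ _⟩

theorem compl_anti {x y : A} (h : x ≤ y) : yᶜ ≤ xᶜ := by
  rw [le_iff] at h ⊢
  rwa [cc, add_comm]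

/-- The lattice order of an MV-algebra: `x ≤ y` if and only if `y = x ⊕ z` for some `z`. -/
instance : Lattice A where
  le_refl x := ⟨0, (add_zero x).symm⟩
  le_trans _ _ _ := le_trans_mv
  le_antisymm x y h h' := by
    rw [le_iff] at h h'
    have := luk' x y
    rw [h, h', one_compl, zero_add, zero_add] at this
    exact this.symm
  sup x y := (xᶜ + y)ᶜ + y
  inf x y := ((xᶜᶜ + yᶜ)ᶜ + yᶜ)ᶜ
  le_sup_left x y := ⟨(yᶜ + x)ᶜ, by rw [luk', add_comm]⟩
  le_sup_right x y := ⟨(xᶜ + y)ᶜ, add_comm _ _⟩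
  sup_le x y z hx hy := by
    have hz : (zᶜ + y)ᶜ + y = z := by
      rw [luk', le_iff.1 hy, one_compl, zero_add]
    have := add_mono (compl_anti (add_mono (compl_anti hx) y)) y
    rwa [hz] at this
  inf_le_left x y := by
    have : xᶜ ≤ (xᶜᶜ + yᶜ)ᶜ + yᶜ := ⟨(yᶜᶜ + xᶜ)ᶜ, by rw [luk', add_comm]⟩
    simpa only [cc] using compl_anti this
  inf_le_right x y := by
    have : yᶜ ≤ (xᶜᶜ + yᶜ)ᶜ + yᶜ := ⟨(xᶜᶜ + yᶜ)ᶜ, add_comm _ _⟩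
    simpa only [cc] using compl_anti this
  le_inf z x y hx hy := by
    have hz : (zᶜᶜ + yᶜ)ᶜ + yᶜ = zᶜ := by
      rw [luk', le_iff.1 (compl_anti hy), one_compl, zero_add]
    have := add_mono (compl_anti (add_mono (compl_anti (compl_anti hx)) yᶜ)) yᶜ
    rw [hz] at this
    simpa only [cc] using compl_anti this

theorem sup_def (x y : A) : x ⊔ y = (xᶜ + y)ᶜ + y := rfl
theorem inf_def (x y : A) : x ⊓ y = ((xᶜᶜ + yᶜ)ᶜ + yᶜ)ᶜ := rfl

instance : IsOrderedAddMonoid A where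
  add_le_add_left _ _ h z := add_mono h z

instance : OrderTop A where
  top := 1
  le_top x := ⟨1, (add_one' x).symm⟩

theorem top_def : (⊤ : A) = 1 := rfl

theorem zero_le_mv (x : A) : 0 ≤ x := ⟨x, (zero_add x).symm⟩
theorem le_one_mv (x : A) : x ≤ 1 := le_top (a := x)

theorem compl_odot (x y : A) : (x ⊙ y)ᶜ = xᶜ + yᶜ := cc _

theorem odot_comm (x y : A) : x ⊙ y = y ⊙ x := by simp only [odot, add_comm]

theorem odot_le_iff {x y z : A} : x ⊙ y ≤ z ↔ x ≤ yᶜ + z := by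
  rw [le_iff, le_iff, compl_odot, add_assoc]

theorem odot_le_iff' {x y z : A} : x ⊙ y ≤ z ↔ y ≤ xᶜ + z := by rw [odot_comm, odot_le_iff]

theorem odot_mono {x x' y y' : A} (h : x ≤ x') (h' : y ≤ y') : x ⊙ y ≤ x' ⊙ y' :=
  compl_anti (add_le_add (compl_anti h) (compl_anti h'))

theorem odot_zero_iff {x y : A} : x ⊙ y = 0 ↔ x ≤ yᶜ := by
  rw [← add_zero yᶜ, ← odot_le_iff]
  exact ⟨fun h => h.le, fun h => le_antisymm h (zero_le_mv _)⟩

theorem odot_one (x : A) : x ⊙ 1 = x := by rw [odot, one_compl, add_zero, cc]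
theorem one_odot (x : A) : 1 ⊙ x = x := by rw [odot_comm, odot_one]

/-- Subtracting a summand of a sum without truncation. -/
theorem add_odot_compl {x y : A} (h : y ≤ xᶜ) : (x + y) ⊙ xᶜ = y := by
  apply compl_inj'
  rw [compl_odot, cc]
  have h3 : (x + y)ᶜ + x = yᶜ ⊔ x := by rw [sup_def, cc, add_comm x y]
  rw [h3]
  exact sup_eq_left.2 (by simpa only [cc] using compl_anti h)

theorem sub_add_of_le {x m : A} (h : m ≤ x) : x ⊙ mᶜ + m = x := by
  have : x ⊔ m = x := sup_eq_left.2 h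
  rwa [sup_def, ← cc m, ← odot, cc] at this

theorem prelinear (x y : A) : (xᶜ + y) ⊔ (yᶜ + x) = 1 := by
  have key : ∀ z : A, z ≤ x ⊙ yᶜ → z ≤ y ⊙ xᶜ → z = 0 := by
    intro z h1 h2
    have h1' : z ≤ x ⊙ (x ⊓ y)ᶜ := h1.trans (odot_mono le_rfl (compl_anti inf_le_right))
    have h2' : z ≤ y ⊙ (x ⊓ y)ᶜ := h2.trans (odot_mono le_rfl (compl_anti inf_le_left))
    have hx : z + x ⊓ y ≤ x := (add_mono h1' _).trans (sub_add_of_le inf_le_left).le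
    have hy : z + x ⊓ y ≤ y := (add_mono h2' _).trans (sub_add_of_le inf_le_right).le
    have hm : x ⊓ y + z = x ⊓ y :=
      le_antisymm (by rw [add_comm]; exact le_inf hx hy) (le_add _ _)
    have hz : z ≤ (x ⊓ y)ᶜ := h1'.trans
      ((odot_mono (le_one_mv x) le_rfl).trans (one_odot _).le)
    rw [← add_odot_compl hz, hm, odot_zero_iff, cc]
  have e1 : (x ⊙ yᶜ)ᶜ = xᶜ + y := by rw [compl_odot, cc]
  have e2 : (y ⊙ xᶜ)ᶜ = yᶜ + x := by rw [compl_odot, cc]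
  rw [← cc ((xᶜ + y) ⊔ (yᶜ + x)), ← compl_zero']
  congr 1
  apply key
  · rw [← cc (x ⊙ yᶜ), e1]; exact compl_anti le_sup_left
  · rw [← cc (y ⊙ xᶜ), e2]; exact compl_anti le_sup_right

theorem odot_le_sq_sup_sq (x y : A) : x ⊙ y ≤ x ⊙ x ⊔ y ⊙ y := by
  have aux : ∀ a b : A, aᶜ + b ≤ (a ⊙ b)ᶜ + b ⊙ b := by
    intro a b
    have h1 : a ⊓ b ≤ b := inf_le_right
    have h2 : a ⊙ (aᶜ + b) ≤ b := odot_le_iff'.2 le_rfl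
    have h3 : (aᶜ + b) ⊙ (a ⊙ b) = (a ⊙ (aᶜ + b)) ⊙ b := by
      apply compl_inj'
      simp only [compl_odot]
      abel
    rw [← odot_le_iff, h3]
    exact odot_mono h2 le_rfl
  have h : (1 : A) ≤ (x ⊙ y)ᶜ + (x ⊙ x ⊔ y ⊙ y) := by
    rw [← prelinear x y]
    apply sup_le
    · exact (aux x y).trans (by gcongr; exact le_sup_right)
    · rw [odot_comm x y]
      exact (aux y x).trans (by gcongr; exact le_sup_left)
  rw [le_iff]
  exact le_antisymm (le_one_mv _) h

/-- Infinitesimal elements: `n x ≤ ¬ x` for all positive integers `n`. -/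
def IsInfinitesimal (x : A) : Prop := ∀ n : ℕ, 0 < n → n • x ≤ xᶜ

/-- Perfect MV-algebras: `A` is the disjoint union of its radical, which is the set of all
infinitesimals, and its co-radical, which is the set of the negations of infinitesimals. -/
class IsPerfect (A : Type*) [MVAlgebra A] : Prop where
  xor : ∀ x : A, Xor (IsInfinitesimal x) (IsInfinitesimal xᶜ)

theorem IsInfinitesimal.mono {x y : A} (hy : IsInfinitesimal y) (h : x ≤ y) :
    IsInfinitesimal x := fun n hn =>
  (nsmul_le_nsmul_right h n).trans ((hy n hn).trans (compl_anti h))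

theorem isInfinitesimal_zero : IsInfinitesimal (0 : A) := fun n _ => by
  rw [smul_zero]; exact zero_le_mv _

theorem IsInfinitesimal.sq {x : A} (hx : IsInfinitesimal x) : x ⊙ x = 0 :=
  odot_zero_iff.2 (by simpa using hx 1 one_pos)

theorem IsInfinitesimal.odot {x y : A} (hx : IsInfinitesimal x) (hy : IsInfinitesimal y) :
    x ⊙ y = 0 := by
  have := odot_le_sq_sup_sq x y
  rw [hx.sq, hy.sq, sup_idem] at this
  exact le_antisymm this (zero_le_mv _)

/-- Associativity of the untruncated sum. -/
theorem le_compl_add {a b c : A} (h : a ≤ bᶜ) (h' : a + b ≤ cᶜ) : a ≤ (b + c)ᶜ := by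
  rw [← add_odot_compl (x := b) (y := a) h, add_comm b a]
  have : (b + c)ᶜ = cᶜ ⊙ bᶜ := by
    apply compl_inj'
    rw [cc, compl_odot, cc, cc, add_comm]
  rw [this]
  exact odot_mono h' le_rfl

theorem IsInfinitesimal.nsmul_le {x : A} (hx : IsInfinitesimal x) (k n : ℕ) :
    k • x ≤ (n • x)ᶜ := by
  have h0 : ∀ m : ℕ, m • x ≤ xᶜ := fun m => by
    rcases Nat.eq_zero_or_pos m with rfl | hm
    · rw [zero_smul]; exact zero_le_mv _
    · exact hx m hm
  induction n with
  | zero => rw [zero_smul, compl_zero']; exact le_one_mv _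
  | succ n ih =>
    rw [succ_nsmul]
    refine le_compl_add ih ?_
    rw [← add_nsmul]
    exact h0 _

theorem IsInfinitesimal.nsmul {x : A} (hx : IsInfinitesimal x) (n : ℕ) :
    IsInfinitesimal (n • x) := fun m _ => by
  rw [← mul_nsmul]
  exact hx.nsmul_le _ _

/-- The elements `x` with `2 x² ≤ x`. -/
def InTheta (x : A) : Prop := x ⊙ x + x ⊙ x ≤ x

theorem IsInfinitesimal.inTheta {x : A} (hx : IsInfinitesimal x) : InTheta x := by
  rw [InTheta, hx.sq, add_zero]; exact zero_le_mv _

theorem inTheta_one : InTheta (1 : A) := le_one_mv _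

section Perfect

variable [IsPerfect A]

theorem zero_ne_one_mv : (0 : A) ≠ 1 := by
  intro h
  have h1 : IsInfinitesimal (0 : A)ᶜ := by
    rw [compl_zero', ← h]; exact isInfinitesimal_zero
  have := IsPerfect.xor (0 : A)
  simp [Xor, isInfinitesimal_zero, h1] at this

theorem isInfinitesimal_or (x : A) : IsInfinitesimal x ∨ IsInfinitesimal xᶜ :=
  Xor.or (IsPerfect.xor x)

theorem not_isInfinitesimal_one : ¬ IsInfinitesimal (1 : A) := by
  intro h
  have := h.sq
  rw [odot_one] at this
  exact zero_ne_one_mv this.symm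

theorem IsInfinitesimal.sup {x y : A} (hx : IsInfinitesimal x) (hy : IsInfinitesimal y) :
    IsInfinitesimal (x ⊔ y) := by
  rcases isInfinitesimal_or (x ⊔ y) with h | h
  · exact h
  · refine h.mono (sup_le ?_ ?_)
    · have h1 : x ⊔ y ≤ xᶜ :=
        sup_le (odot_zero_iff.1 hx.sq) (odot_zero_iff.1 (hy.odot hx))
      simpa only [cc] using compl_anti h1
    · have h1 : x ⊔ y ≤ yᶜ :=
        sup_le (odot_zero_iff.1 (hx.odot hy)) (odot_zero_iff.1 hy.sq)
      simpa only [cc] using compl_anti h1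

theorem IsInfinitesimal.add {x y : A} (hx : IsInfinitesimal x) (hy : IsInfinitesimal y) :
    IsInfinitesimal (x + y) := by
  refine ((hx.sup hy).nsmul 2).mono ?_
  rw [two_nsmul]
  exact add_le_add le_sup_left le_sup_right

theorem inTheta_iff {x : A} : InTheta x ↔ IsInfinitesimal x ∨ x = 1 := by
  constructor
  · intro h
    rcases isInfinitesimal_or x with h' | h'
    · exact Or.inl h'
    · right
      have h2 := (h'.nsmul 2).sq
      have h3 : x ⊙ x + x ⊙ x = 1 := by
        rw [← compl_zero', ← h2, two_nsmul, compl_odot]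
        rfl
      rw [InTheta, h3] at h
      exact le_antisymm (le_one_mv x) h
  · rintro (h | rfl)
    · exact h.inTheta
    · exact inTheta_one

theorem inTheta_add {x y : A} (hx : InTheta x) (hy : InTheta y) : InTheta (x + y) := by
  rcases inTheta_iff.1 hx with h | rfl
  · rcases inTheta_iff.1 hy with h' | rfl
    · exact (h.add h').inTheta
    · rw [add_one']; exact inTheta_one
  · rw [add_comm, add_one']; exact inTheta_one

theorem inTheta_sup {x y : A} (hx : InTheta x) (hy : InTheta y) : InTheta (x ⊔ y) := by
  rcases inTheta_iff.1 hx with h | rfl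
  · rcases inTheta_iff.1 hy with h' | rfl
    · exact (h.sup h').inTheta
    · rw [sup_eq_right.2 (le_one_mv x)]; exact inTheta_one
  · rw [sup_eq_left.2 (le_one_mv y)]; exact inTheta_one

theorem inTheta_inf {x y : A} (hx : InTheta x) (hy : InTheta y) : InTheta (x ⊓ y) := by
  rcases inTheta_iff.1 hx with h | rfl
  · exact (h.mono inf_le_left).inTheta
  · rwa [inf_eq_right.2 (le_one_mv y)]

end Perfect

end MVAlgebra

/-- Homomorphisms of MV-algebras. -/
@[ext]
structure MVHom (A B : Type*) [MVAlgebra A] [MVAlgebra B] extends A →+ B where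
  map_compl' : ∀ x : A, toFun xᶜ = (toFun x)ᶜ

namespace MVHom

open MVAlgebra

variable {A B C : Type*} [MVAlgebra A] [MVAlgebra B] [MVAlgebra C]

instance : FunLike (MVHom A B) A B where
  coe f := f.toFun
  coe_injective _ _ h := MVHom.ext h

/-- The identity homomorphism. -/
def id (A : Type*) [MVAlgebra A] : MVHom A A where
  __ := AddMonoidHom.id A
  map_compl' _ := rfl

/-- Composition of homomorphisms. -/
def comp (g : MVHom B C) (f : MVHom A B) : MVHom A C where
  __ := g.toAddMonoidHom.comp f.toAddMonoidHom
  map_compl' x := (congrArg g (f.map_compl' x)).trans (g.map_compl' _)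

protected theorem map_zero (f : MVHom A B) : f 0 = 0 := f.map_zero'
protected theorem map_add (f : MVHom A B) (x y : A) : f (x + y) = f x + f y := f.map_add' x y
protected theorem map_compl (f : MVHom A B) (x : A) : f xᶜ = (f x)ᶜ := f.map_compl' x
protected theorem map_one (f : MVHom A B) : f 1 = 1 := by
  rw [← compl_zero', f.map_compl, f.map_zero, compl_zero']
protected theorem map_odot (f : MVHom A B) (x y : A) : f (x ⊙ y) = f x ⊙ f y := by
  simp only [odot, f.map_compl, f.map_add]
protected theorem map_sup (f : MVHom A B) (x y : A) : f (x ⊔ y) = f x ⊔ f y := by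
  simp only [sup_def, f.map_compl, f.map_add]
protected theorem map_inf (f : MVHom A B) (x y : A) : f (x ⊓ y) = f x ⊓ f y := by
  simp only [inf_def, f.map_compl, f.map_add]

protected theorem monotone (f : MVHom A B) {x y : A} (h : x ≤ y) : f x ≤ f y := by
  obtain ⟨z, rfl⟩ := h
  exact ⟨f z, f.map_add x z⟩

protected theorem map_nsmul (f : MVHom A B) (n : ℕ) (x : A) : f (n • x) = n • f x :=
  f.toAddMonoidHom.map_nsmul n x

theorem map_isInfinitesimal (f : MVHom A B) {x : A} (h : IsInfinitesimal x) :
    IsInfinitesimal (f x) := fun n hn => by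
  rw [← f.map_nsmul, ← f.map_compl]
  exact f.monotone (h n hn)

theorem map_inTheta (f : MVHom A B) {x : A} (h : InTheta x) : InTheta (f x) := by
  rw [InTheta, ← f.map_odot, ← f.map_add]
  exact f.monotone h

end MVHom

/-- The category of perfect MV-algebras. -/
structure PerfMV : Type (u + 1) where
  carrier : Type u
  [mvAlgebra : MVAlgebra carrier]
  [isPerfect : MVAlgebra.IsPerfect carrier]

namespace PerfMV

instance : CoeSort PerfMV.{u} (Type u) := ⟨carrier⟩

attribute [instance] mvAlgebra isPerfect

instance : Category PerfMV.{u} where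
  Hom A B := MVHom A B
  id A := MVHom.id A
  comp f g := g.comp f

end PerfMV

/-! ## Mundici's functor `Γ` and the functor `Δ` -/

/-- The interval `[0, w]` of a lattice-ordered group. -/
@[ext]
structure Gamma (G : Type u) [AddCommGroup G] [Lattice G] (w : G) : Type u where
  val : G
  nonneg : 0 ≤ val
  le : val ≤ w

namespace Gamma

variable {G : Type u} [AddCommGroup G] [Lattice G] [IsOrderedAddMonoid G] {w : G}

instance [hw : Fact (0 ≤ w)] : Zero (Gamma G w) := ⟨⟨0, le_rfl, hw.out⟩⟩
instance [hw : Fact (0 ≤ w)] : Add (Gamma G w) :=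
  ⟨fun x y => ⟨(x.val + y.val) ⊓ w, le_inf (add_nonneg x.nonneg y.nonneg) hw.out, inf_le_right⟩⟩

/-- `Γ(G, w)`: the interval `[0, w]` with `x ⊕ y = (x + y) ∧ w` and `¬ x = w - x`. -/
instance [hw : Fact (0 ≤ w)] : MVAlgebra (Gamma G w) where
  one := ⟨w, hw.out, le_rfl⟩
  compl x := ⟨w - x.val, sub_nonneg.2 x.le, sub_le_self _ x.nonneg⟩
  nsmul := nsmulRec
  add_assoc x y z := Gamma.ext (by
    change ((x.val + y.val) ⊓ w + z.val) ⊓ w = (x.val + (y.val + z.val) ⊓ w) ⊓ w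
    rw [inf_add, add_inf, inf_assoc, inf_assoc, inf_eq_right.2 (le_add_of_nonneg_right z.nonneg),
      inf_eq_right.2 (le_add_of_nonneg_left x.nonneg), add_assoc])
  zero_add x := Gamma.ext (by
    change (0 + x.val) ⊓ w = x.val
    rw [zero_add, inf_eq_left.2 x.le])
  add_zero x := Gamma.ext (by
    change (x.val + 0) ⊓ w = x.val
    rw [add_zero, inf_eq_left.2 x.le])
  add_comm x y := Gamma.ext (by
    change (x.val + y.val) ⊓ w = (y.val + x.val) ⊓ w
    rw [add_comm])
  compl_zero' := Gamma.ext (sub_zero w)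
  add_one' x := Gamma.ext (inf_eq_right.2 (le_add_of_nonneg_left x.nonneg))
  compl_compl' x := Gamma.ext (sub_sub_cancel w x.val)
  luk' x y := Gamma.ext (by
    have key : ∀ a b : G, w - (w - a + b) ⊓ w + b = a ⊔ b := fun a b => by
      rw [sub_inf, sub_self, sup_add, zero_add]
      congr 1
      abel
    change (w - (w - x.val + y.val) ⊓ w + y.val) ⊓ w = (w - (w - y.val + x.val) ⊓ w + x.val) ⊓ w
    rw [key, key, sup_comm])

section

variable [Fact (0 ≤ w)]

theorem add_val (x y : Gamma G w) : (x + y).val = (x.val + y.val) ⊓ w := rfl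
theorem zero_val : (0 : Gamma G w).val = 0 := rfl
theorem one_val : (1 : Gamma G w).val = w := rfl
theorem compl_val (x : Gamma G w) : xᶜ.val = w - x.val := rfl

theorem le_iff_val {x y : Gamma G w} : x ≤ y ↔ x.val ≤ y.val := by
  rw [MVAlgebra.le_iff, Gamma.ext_iff, add_val, compl_val, one_val, inf_eq_right,
    ← sub_nonneg, ← sub_nonneg (a := y.val)]
  rw [show w - x.val + y.val - w = y.val - x.val by abel]

end

/-- A homomorphism of lattice-ordered groups carrying `w` to `w'` restricts to the intervals. -/
def map {H : Type u} [AddCommGroup H] [Lattice H] [IsOrderedAddMonoid H] {w' : H}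
    [Fact (0 ≤ w)] [Fact (0 ≤ w')] (f : LatGroupHom G H) (hf : f w = w') :
    MVHom (Gamma G w) (Gamma H w') where
  toFun x := ⟨f x.val, f.map_zero ▸ f.monotone x.nonneg, hf ▸ f.monotone x.le⟩
  map_zero' := Gamma.ext f.map_zero
  map_add' x y := Gamma.ext (by simp only [add_val, f.map_inf, f.map_add, hf])
  map_compl' x := Gamma.ext (by simp only [compl_val, f.map_sub, hf])

end Gamma

/-! The lexicographic product of the integers with a lattice-ordered group -/

namespace LexInt

variable {G : Type u}

section Lattice

variable [Lattice G]

theorem le_iff {x y : ℤ ×ₗ G} :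
    x ≤ y ↔ (ofLex x).1 < (ofLex y).1 ∨ (ofLex x).1 = (ofLex y).1 ∧ (ofLex x).2 ≤ (ofLex y).2 :=
  Prod.Lex.le_iff

/-- Binary suprema and infima for the lexicographic order. -/
noncomputable instance : Lattice (ℤ ×ₗ G) where
  sup x y := toLex
    (if (ofLex x).1 < (ofLex y).1 then ofLex y
      else if (ofLex y).1 < (ofLex x).1 then ofLex x
      else ((ofLex x).1, (ofLex x).2 ⊔ (ofLex y).2))
  inf x y := toLex
    (if (ofLex x).1 < (ofLex y).1 then ofLex x
      else if (ofLex y).1 < (ofLex x).1 then ofLex y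
      else ((ofLex x).1, (ofLex x).2 ⊓ (ofLex y).2))
  le_sup_left x y := by
    rw [le_iff, ofLex_toLex]
    split_ifs with h1 h2
    · exact Or.inl h1
    · exact Or.inr ⟨rfl, le_rfl⟩
    · exact Or.inr ⟨rfl, le_sup_left⟩
  le_sup_right x y := by
    rw [le_iff, ofLex_toLex]
    split_ifs with h1 h2
    · exact Or.inr ⟨rfl, le_rfl⟩
    · exact Or.inl h2
    · exact Or.inr ⟨by simp only; omega, le_sup_right⟩
  sup_le x y z hx hy := by
    rw [le_iff] at hx hy ⊢
    rw [ofLex_toLex]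
    split_ifs with h1 h2
    · exact hy
    · exact hx
    · rcases hx with hx | hx
      · exact Or.inl hx
      · rcases hy with hy | hy
        · exact Or.inl (by simp only; omega)
        · exact Or.inr ⟨hx.1, sup_le hx.2 hy.2⟩
  inf_le_left x y := by
    rw [le_iff, ofLex_toLex]
    split_ifs with h1 h2
    · exact Or.inr ⟨rfl, le_rfl⟩
    · exact Or.inl h2
    · exact Or.inr ⟨rfl, inf_le_left⟩
  inf_le_right x y := by
    rw [le_iff, ofLex_toLex]
    split_ifs with h1 h2
    · exact Or.inl h1
    · exact Or.inr ⟨rfl, le_rfl⟩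
    · exact Or.inr ⟨by simp only; omega, inf_le_right⟩
  le_inf z x y hx hy := by
    rw [le_iff] at hx hy ⊢
    rw [ofLex_toLex]
    split_ifs with h1 h2
    · exact hx
    · exact hy
    · rcases hx with hx | hx
      · exact Or.inl hx
      · rcases hy with hy | hy
        · exact Or.inl (by simp only; omega)
        · exact Or.inr ⟨hx.1, le_inf hx.2 hy.2⟩

theorem sup_def (x y : ℤ ×ₗ G) : x ⊔ y = toLex
    (if (ofLex x).1 < (ofLex y).1 then ofLex y
      else if (ofLex y).1 < (ofLex x).1 then ofLex x
      else ((ofLex x).1, (ofLex x).2 ⊔ (ofLex y).2)) := rfl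
theorem inf_def (x y : ℤ ×ₗ G) : x ⊓ y = toLex
    (if (ofLex x).1 < (ofLex y).1 then ofLex x
      else if (ofLex y).1 < (ofLex x).1 then ofLex y
      else ((ofLex x).1, (ofLex x).2 ⊓ (ofLex y).2)) := rfl

end Lattice

variable [AddCommGroup G] [Lattice G]

instance [IsOrderedAddMonoid G] : IsOrderedAddMonoid (ℤ ×ₗ G) where
  add_le_add_left x y h z := by
    rw [le_iff] at h ⊢
    rcases h with h | h
    · exact Or.inl (add_lt_add_left h _)
    · exact Or.inr ⟨congrArg (· + (ofLex z).1) h.1, add_le_add_left h.2 _⟩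

/-- The element `(1, 0)`. -/
def unit (G : Type u) [AddCommGroup G] : ℤ ×ₗ G := toLex (1, 0)

instance : Fact (0 ≤ unit G) := ⟨le_iff.2 (Or.inl one_pos)⟩

/-- The map `(n, g) ↦ (n, f g)`. -/
def map {H : Type u} [AddCommGroup H] [Lattice H] (f : LatGroupHom G H) :
    LatGroupHom (ℤ ×ₗ G) (ℤ ×ₗ H) where
  toFun x := toLex ((ofLex x).1, f (ofLex x).2)
  map_zero' := congrArg toLex (Prod.ext rfl f.map_zero)
  map_add' x y := congrArg toLex (Prod.ext rfl (f.map_add _ _))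
  map_sup' x y := by
    simp only [sup_def, ofLex_toLex]
    split_ifs <;> simp [f.map_sup, *]
  map_inf' x y := by
    simp only [inf_def, ofLex_toLex]
    split_ifs <;> simp [f.map_inf, *]

theorem map_unit {H : Type u} [AddCommGroup H] [Lattice H] (f : LatGroupHom G H) :
    map f (unit G) = unit H := congrArg toLex (Prod.ext rfl f.map_zero)

end LexInt

/-- `Δ(G) = Γ(ℤ ×ₗ G, (1, 0))`. -/
abbrev Delta (G : Type u) [AddCommGroup G] [Lattice G] [IsOrderedAddMonoid G] : Type u :=
  Gamma (ℤ ×ₗ G) (LexInt.unit G)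

namespace Delta

open MVAlgebra

variable {G : Type u} [AddCommGroup G] [Lattice G] [IsOrderedAddMonoid G]

theorem fst_eq (x : Delta G) : (ofLex x.val).1 = 0 ∨ (ofLex x.val).1 = 1 := by
  have h1 : 0 ≤ (ofLex x.val).1 := by
    rcases LexInt.le_iff.1 x.nonneg with h | h
    · exact h.le
    · exact h.1.le
  have h2 : (ofLex x.val).1 ≤ 1 := by
    rcases LexInt.le_iff.1 x.le with h | h
    · exact h.le
    · exact h.1.le
  omega

theorem fst_nsmul {x : Delta G} (h : (ofLex x.val).1 = 0) (n : ℕ) :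
    (ofLex (n • x).val).1 = 0 := by
  induction n with
  | zero => rw [zero_smul]; rfl
  | succ n ih =>
    have hs : (ofLex ((n • x).val + x.val)).1 = 0 := by
      change (ofLex (n • x).val).1 + (ofLex x.val).1 = 0
      rw [ih, h, add_zero]
    rw [succ_nsmul, Gamma.add_val, LexInt.inf_def, if_pos]
    · exact hs
    · rw [hs]; exact one_pos

theorem isInfinitesimal_iff (x : Delta G) : IsInfinitesimal x ↔ (ofLex x.val).1 = 0 := by
  constructor
  · intro h
    rcases fst_eq x with h0 | h1
    · exact h0
    · have h2 := Gamma.le_iff_val.1 (h 1 one_pos)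
      rw [one_smul, Gamma.compl_val, LexInt.le_iff] at h2
      have h3 : (ofLex (LexInt.unit G - x.val)).1 = 1 - (ofLex x.val).1 := rfl
      rw [h3] at h2
      rcases h2 with h2 | h2 <;> omega
  · intro h n _
    rw [Gamma.le_iff_val, Gamma.compl_val, LexInt.le_iff]
    left
    have h3 : (ofLex (LexInt.unit G - x.val)).1 = 1 - (ofLex x.val).1 := rfl
    rw [h3, fst_nsmul h, h]
    norm_num

instance : IsPerfect (Delta G) where
  xor x := by
    rw [isInfinitesimal_iff, isInfinitesimal_iff]
    have h3 : (ofLex xᶜ.val).1 = 1 - (ofLex x.val).1 := rfl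
    rw [h3]
    rcases fst_eq x with h | h <;> simp [h, Xor]

end Delta

/-- The functor `Δ` from abelian lattice-ordered groups to perfect MV-algebras. -/
noncomputable def deltaFunctor : AbLatGroup.{u} ⥤ PerfMV.{u} where
  obj G := { carrier := Delta G }
  map f := Gamma.map (LexInt.map f) (LexInt.map_unit f)

/-! ## The category `TOP` -/

/-- The category `TOP`. An object is (up to an isomorphism of its order and addition) the positive
cone `{g | 0 ≤ g}` of an abelian lattice-ordered group with a top element adjoined, for which
`⊤ + x = ⊤`. The elements other than `⊤` form the positive cone of the object. -/
structure ConeTop : Type (u + 1) where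
  carrier : Type u
  [addCommMonoid : AddCommMonoid carrier]
  [lattice : Lattice carrier]
  [orderTop : OrderTop carrier]
  isCone : ∃ G : AbLatGroup.{u}, Nonempty (carrier ≃+o WithTop {g : G // 0 ≤ g})

/-- Morphisms of `TOP`: they preserve the operations `+`, `0`, `⊔`, `⊓`, the positive cone, and the
top element. -/
@[ext]
structure ConeTopHom (S T : Type*) [AddCommMonoid S] [Lattice S] [OrderTop S]
    [AddCommMonoid T] [Lattice T] [OrderTop T] extends S →+ T where
  map_sup' : ∀ x y : S, toFun (x ⊔ y) = toFun x ⊔ toFun y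
  map_inf' : ∀ x y : S, toFun (x ⊓ y) = toFun x ⊓ toFun y
  map_cone' : ∀ x : S, x ≠ ⊤ → toFun x ≠ ⊤
  map_top' : toFun ⊤ = ⊤

namespace ConeTopHom

variable {R S T : Type*} [AddCommMonoid R] [Lattice R] [OrderTop R]
  [AddCommMonoid S] [Lattice S] [OrderTop S] [AddCommMonoid T] [Lattice T] [OrderTop T]

instance : FunLike (ConeTopHom S T) S T where
  coe f := f.toFun
  coe_injective _ _ h := ConeTopHom.ext h

/-- The identity morphism. -/
def id (S : Type*) [AddCommMonoid S] [Lattice S] [OrderTop S] : ConeTopHom S S where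
  __ := AddMonoidHom.id S
  map_sup' _ _ := rfl
  map_inf' _ _ := rfl
  map_cone' _ h := h
  map_top' := rfl

/-- Composition of morphisms. -/
def comp (g : ConeTopHom S T) (f : ConeTopHom R S) : ConeTopHom R T where
  __ := g.toAddMonoidHom.comp f.toAddMonoidHom
  map_sup' x y := (congrArg g (f.map_sup' x y)).trans (g.map_sup' _ _)
  map_inf' x y := (congrArg g (f.map_inf' x y)).trans (g.map_inf' _ _)
  map_cone' x h := g.map_cone' _ (f.map_cone' x h)
  map_top' := (congrArg g f.map_top').trans g.map_top'

end ConeTopHom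

namespace ConeTop

instance : CoeSort ConeTop.{u} (Type u) := ⟨carrier⟩

attribute [instance] addCommMonoid lattice orderTop

instance : Category ConeTop.{u} where
  Hom S T := ConeTopHom S T
  id S := ConeTopHom.id S
  comp f g := g.comp f

end ConeTop

/-! A lattice-ordered cancellative monoid with the order of divisibility is the positive cone of an
abelian lattice-ordered group. This is needed to see that `θ` takes its values in `TOP`. -/

namespace Cone

/-- The group of differences. -/
abbrev Diff (M : Type u) [AddCommMonoid M] : Type u := Algebra.GrothendieckAddGroup M

/-- The difference `a - b`. -/
def mk {M : Type u} [AddCommMonoid M] (a b : M) : Diff M := AddLocalization.mk a ⟨b, trivial⟩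

section

variable {M : Type u} [AddCommMonoid M]

theorem mk_add_mk (a b c d : M) : mk a b + mk c d = mk (a + c) (b + d) :=
  AddLocalization.mk_add _ _ _ _

theorem zero_eq : (0 : Diff M) = mk 0 0 := AddLocalization.mk_zero.symm

theorem neg_mk (a b : M) : -mk a b = mk b a := Algebra.GrothendieckAddGroup.neg_mk _ _

theorem exists_mk (x : Diff M) : ∃ a b : M, x = mk a b := by
  induction x using AddLocalization.ind with
  | _ p => exact ⟨p.1, p.2.1, rfl⟩

end

section

variable {M : Type u} [AddCommMonoid M] [Lattice M] [IsOrderedCancelAddMonoid M]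

theorem sup_add_le (hM : ∀ a b : M, a ≤ b → ∃ c, b = a + c) (hM' : ∀ a b : M, a ≤ a + b)
    {a b c d : M} (h : c + a ≤ d) (h' : c + b ≤ d) : c + (a ⊔ b) ≤ d := by
  obtain ⟨e, rfl⟩ := hM c d ((hM' c a).trans h)
  exact add_le_add_right (sup_le (le_of_add_le_add_left h) (le_of_add_le_add_left h')) c

theorem mk_le_mk {a b c d : M} : mk a b ≤ mk c d ↔ d + a ≤ b + c := Iff.rfl

theorem mk_eq_mk {a b c d : M} : mk a b = mk c d ↔ d + a = b + c := by
  constructor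
  · intro h
    exact le_antisymm (mk_le_mk.1 h.le) (mk_le_mk.1 h.ge)
  · intro h
    exact le_antisymm (mk_le_mk.2 h.le) (mk_le_mk.2 h.ge)

instance : IsOrderedAddMonoid (Diff M) where
  add_le_add_left x y h z := by
    obtain ⟨a, b, rfl⟩ := exists_mk x
    obtain ⟨c, d, rfl⟩ := exists_mk y
    obtain ⟨e, f, rfl⟩ := exists_mk z
    rw [mk_add_mk, mk_add_mk, mk_le_mk]
    rw [mk_le_mk] at h
    calc d + f + (a + e) = (d + a) + (f + e) := by abel
      _ ≤ (b + c) + (f + e) := add_le_add_left h _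
      _ = b + f + (c + e) := by abel

theorem exists_isLUB (hM : ∀ a b : M, a ≤ b → ∃ c, b = a + c) (hM' : ∀ a b : M, a ≤ a + b)
    (x y : Diff M) : ∃ z, IsLUB {x, y} z := by
  obtain ⟨a, b, rfl⟩ := exists_mk x
  obtain ⟨c, d, rfl⟩ := exists_mk y
  have h1 : mk a b = mk (d + a) (b + d) := mk_eq_mk.2 (by abel)
  have h2 : mk c d = mk (b + c) (b + d) := mk_eq_mk.2 (by abel)
  refine ⟨mk ((d + a) ⊔ (b + c)) (b + d), ?_, ?_⟩
  · rintro z (rfl | rfl)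
    · rw [h1, mk_le_mk]; exact add_le_add_right le_sup_left _
    · rw [h2, mk_le_mk]; exact add_le_add_right le_sup_right _
  · intro z hz
    have hz1 := hz (Set.mem_insert _ _)
    have hz2 := hz (Set.mem_insert_of_mem _ rfl)
    obtain ⟨e, f, rfl⟩ := exists_mk z
    rw [h1, mk_le_mk] at hz1
    rw [h2, mk_le_mk] at hz2
    exact mk_le_mk.2 (sup_add_le hM hM' hz1 hz2)

/-- The group of differences is lattice-ordered. -/
noncomputable abbrev diffLattice (hM : ∀ a b : M, a ≤ b → ∃ c, b = a + c)
    (hM' : ∀ a b : M, a ≤ a + b) : Lattice (Diff M) where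
  __ := (inferInstance : PartialOrder (Diff M))
  sup x y := (exists_isLUB hM hM' x y).choose
  le_sup_left x y := (exists_isLUB hM hM' x y).choose_spec.1 (Set.mem_insert _ _)
  le_sup_right x y := (exists_isLUB hM hM' x y).choose_spec.1 (Set.mem_insert_of_mem _ rfl)
  sup_le x y z hx hy := (exists_isLUB hM hM' x y).choose_spec.2 (by
    rintro w (rfl | rfl)
    · exact hx
    · exact hy)
  inf x y := -(exists_isLUB hM hM' (-x) (-y)).choose
  inf_le_left x y :=
    neg_le.1 ((exists_isLUB hM hM' (-x) (-y)).choose_spec.1 (Set.mem_insert _ _))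
  inf_le_right x y :=
    neg_le.1 ((exists_isLUB hM hM' (-x) (-y)).choose_spec.1 (Set.mem_insert_of_mem _ rfl))
  le_inf x y z hx hy := le_neg.1 ((exists_isLUB hM hM' (-y) (-z)).choose_spec.2 (by
    rintro w (rfl | rfl)
    · exact neg_le_neg hx
    · exact neg_le_neg hy))

theorem exists_group (hM : ∀ a b : M, a ≤ b → ∃ c, b = a + c) (hM' : ∀ a b : M, a ≤ a + b) :
    ∃ (G : AbLatGroup.{u}) (e : M → {g : G // 0 ≤ g}), Function.Surjective e ∧
      (∀ a b, e (a + b) = e a + e b) ∧ ∀ a b, e a ≤ e b ↔ a ≤ b := by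
  let _ := diffLattice hM hM'
  have hpos : ∀ a : M, (0 : Diff M) ≤ mk a 0 := fun a => by
    rw [zero_eq, mk_le_mk]
    simpa using hM' 0 a
  refine ⟨{ carrier := Diff M }, fun a => ⟨mk a 0, hpos a⟩, ?_, ?_, ?_⟩
  · rintro ⟨x, hx⟩
    obtain ⟨a, b, rfl⟩ := exists_mk x
    rw [zero_eq] at hx
    have hx' : b + 0 ≤ 0 + a := hx
    rw [add_zero, zero_add] at hx'
    obtain ⟨c, rfl⟩ := hM b a hx'
    exact ⟨c, Subtype.ext (mk_eq_mk.2 (by abel))⟩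
  · intro a b
    refine Subtype.ext ?_
    change mk (a + b) 0 = mk a 0 + mk b 0
    rw [mk_add_mk, add_zero]
  · intro a b
    change 0 + a ≤ 0 + b ↔ a ≤ b
    rw [zero_add, zero_add]

end

theorem isCone_of {T : Type u} [AddCommMonoid T] [Lattice T] [OrderTop T] (P : AddSubmonoid T)
    (hP : ∀ x, x ∈ P ↔ x ≠ ⊤) (htop : ∀ x : T, ⊤ + x = ⊤)
    (hsup : ∀ x y, x ∈ P → y ∈ P → x ⊔ y ∈ P) (hinf : ∀ x y, x ∈ P → y ∈ P → x ⊓ y ∈ P)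
    (hle : ∀ x y : T, x ≤ y ↔ ∃ z, y = x + z)
    (hcancel : ∀ x y z, x ∈ P → y ∈ P → z ∈ P → x + y ≤ x + z → y ≤ z) :
    ∃ G : AbLatGroup.{u}, Nonempty (T ≃+o WithTop {g : G // 0 ≤ g}) := by
  classical
  let _ : Lattice P := Subtype.lattice (fun x y hx hy => hsup x y hx hy)
    (fun x y hx hy => hinf x y hx hy)
  have hadd : ∀ x y : P, x ≤ y → ∀ z : P, x + z ≤ y + z := by
    intro x y h z
    obtain ⟨w, hw⟩ := (hle x.1 y.1).1 h
    exact (hle (x + z).1 (y + z).1).2 ⟨w, by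
      change y.1 + z.1 = x.1 + z.1 + w
      rw [hw, add_right_comm]⟩
  have : IsOrderedCancelAddMonoid P :=
    { add_le_add_left := hadd
      le_of_add_le_add_left := fun x y z h => hcancel x.1 y.1 z.1 x.2 y.2 z.2 h }
  obtain ⟨G, e, hes, hea, hel⟩ := exists_group (M := P)
    (by
      intro a b h
      obtain ⟨w, hw⟩ := (hle a.1 b.1).1 h
      refine ⟨⟨w, (hP w).2 ?_⟩, Subtype.ext hw⟩
      rintro rfl
      rw [add_comm, htop] at hw
      exact (hP _).1 b.2 hw)
    (fun a b => (hle a.1 (a + b).1).2 ⟨b.1, rfl⟩)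
  let F : T → WithTop {g : G // 0 ≤ g} := fun x => if h : x = ⊤ then ⊤ else (e ⟨x, (hP x).2 h⟩ :)
  have Ftop : F ⊤ = ⊤ := dif_pos rfl
  have Fcoe : ∀ x : P, F x.1 = (e x : WithTop _) := fun x => dif_neg ((hP _).1 x.2)
  have hcases : ∀ x : T, x = ⊤ ∨ ∃ y : P, x = y.1 := fun x => by
    by_cases h : x = ⊤
    · exact Or.inl h
    · exact Or.inr ⟨⟨x, (hP x).2 h⟩, rfl⟩
  have Fle : ∀ x y, F x ≤ F y ↔ x ≤ y := by
    intro x y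
    rcases hcases y with rfl | ⟨y, rfl⟩
    · simp [Ftop]
    · rcases hcases x with rfl | ⟨x, rfl⟩
      · rw [Ftop, Fcoe, top_le_iff, top_le_iff]
        simpa using (hP _).1 y.2
      · rw [Fcoe, Fcoe, WithTop.coe_le_coe, hel]
        rfl
  have Fadd : ∀ x y, F (x + y) = F x + F y := by
    intro x y
    rcases hcases y with rfl | ⟨y, rfl⟩
    · rw [add_comm, htop, Ftop, WithTop.add_top]
    · rcases hcases x with rfl | ⟨x, rfl⟩
      · rw [htop, Ftop, WithTop.top_add]
      · have h := Fcoe (x + y)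
        rw [hea] at h
        rw [Fcoe, Fcoe, ← WithTop.coe_add]
        exact h
  have Finj : Function.Injective F := fun x y h =>
    le_antisymm ((Fle x y).1 h.le) ((Fle y x).1 h.ge)
  have Fsurj : Function.Surjective F := by
    intro z
    induction z with
    | top => exact ⟨⊤, Ftop⟩
    | coe z =>
      obtain ⟨x, rfl⟩ := hes z
      exact ⟨x.1, Fcoe x⟩
  exact ⟨G, ⟨{
    toEquiv := Equiv.ofBijective F ⟨Finj, Fsurj⟩
    map_add' := Fadd
    map_le_map_iff' := Fle _ _ }⟩⟩

end Cone

/-! ## The functor `θ` -/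

open MVAlgebra in
/-- `θ(A) = {x ∈ A | 2 x² ≤ x}`. -/
def thetaSubmonoid (A : Type u) [MVAlgebra A] [IsPerfect A] : AddSubmonoid A where
  carrier := {x | x ⊙ x + x ⊙ x ≤ x}
  zero_mem' := isInfinitesimal_zero.inTheta
  add_mem' := inTheta_add

/-- `θ(A)`, with the operations inherited from `A`. -/
abbrev Theta (A : Type u) [MVAlgebra A] [MVAlgebra.IsPerfect A] : Type u := thetaSubmonoid A

namespace Theta

open MVAlgebra

variable (A : Type u) [MVAlgebra A] [IsPerfect A]

instance : Lattice (Theta A) :=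
  Subtype.lattice (fun _ _ hx hy => inTheta_sup hx hy) (fun _ _ hx hy => inTheta_inf hx hy)

instance : OrderTop (Theta A) where
  top := ⟨1, inTheta_one⟩
  le_top x := le_one_mv x.1

variable {A} in
theorem ne_top_iff {x : Theta A} : x ≠ ⊤ ↔ IsInfinitesimal x.1 := by
  constructor
  · intro h
    rcases inTheta_iff.1 x.2 with h' | h'
    · exact h'
    · exact absurd (Subtype.ext h') h
  · rintro h rfl
    exact not_isInfinitesimal_one h

theorem isCone : ∃ G : AbLatGroup.{u}, Nonempty (Theta A ≃+o WithTop {g : G // 0 ≤ g}) := by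
  refine Cone.isCone_of
    { carrier := {x : Theta A | IsInfinitesimal x.1}
      zero_mem' := isInfinitesimal_zero
      add_mem' := fun hx hy => IsInfinitesimal.add hx hy }
    (fun x => ne_top_iff.symm) ?_ ?_ ?_ ?_ ?_
  · intro x
    refine Subtype.ext ?_
    change (1 : A) + x.1 = 1
    rw [add_comm, add_one']
  · exact fun x y hx hy => IsInfinitesimal.sup hx hy
  · exact fun x y hx hy => IsInfinitesimal.mono hx inf_le_left
  · intro x y
    constructor
    · intro h
      by_cases hy : y = ⊤
      · refine ⟨⊤, ?_⟩
        rw [hy]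
        refine Subtype.ext ?_
        change (1 : A) = x.1 + 1
        rw [add_one']
      · obtain ⟨z, hz⟩ := MVAlgebra.le_def.1 (show x.1 ≤ y.1 from h)
        have hz' : z ≤ y.1 := by rw [hz, add_comm]; exact le_add _ _
        exact ⟨⟨z, ((ne_top_iff.1 hy).mono hz').inTheta⟩, Subtype.ext hz⟩
    · rintro ⟨z, rfl⟩
      exact le_add x.1 z.1
  · intro x y z hx hy hz h
    have h1 := odot_mono (show x.1 + y.1 ≤ x.1 + z.1 from h) (le_refl x.1ᶜ)
    rw [add_odot_compl (odot_zero_iff.1 (IsInfinitesimal.odot hy hx)),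
      add_odot_compl (odot_zero_iff.1 (IsInfinitesimal.odot hz hx))] at h1
    exact h1

variable {A} in
/-- A homomorphism of perfect MV-algebras restricts to `θ`. -/
def map {B : Type u} [MVAlgebra B] [IsPerfect B] (f : MVHom A B) :
    ConeTopHom (Theta A) (Theta B) where
  toFun x := ⟨f x.1, f.map_inTheta x.2⟩
  map_zero' := Subtype.ext f.map_zero
  map_add' x y := Subtype.ext (f.map_add x.1 y.1)
  map_sup' x y := Subtype.ext (f.map_sup x.1 y.1)
  map_inf' x y := Subtype.ext (f.map_inf x.1 y.1)
  map_cone' x hx := ne_top_iff.2 (f.map_isInfinitesimal (ne_top_iff.1 hx))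
  map_top' := Subtype.ext f.map_one

end Theta

/-- The functor `θ` from perfect MV-algebras to `TOP`. -/
def thetaFunctor : PerfMV.{u} ⥤ ConeTop.{u} where
  obj A := { carrier := Theta A, isCone := Theta.isCone A }
  map f := Theta.map f

/-! ## The composite functor is an equivalence

Removing the zero is an equivalence from additively idempotent semifields to abelian lattice-ordered
groups: an inverse adjoins to `G` a zero element, with the sum of `G` as product and the supremum as
sum.

The elements of `θ(Δ(G))` are the `(0, g)` with `g ≥ 0` and the top element `(1, 0)`, so `θ ∘ Δ` is
naturally isomorphic to `G ↦ G⁺ ∪ {⊤}`, which is essentially surjective by the definition of `TOP`.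
It is faithful because every element of `G` is a difference of positive ones. It is full because a
map `k` of positive cones extends to `G` by `a - b ↦ k a - k b`, and adding `x⁻ + y⁻` to `x`, `y`
and `x ⊔ y` makes them positive, so that the extension preserves suprema as soon as `k` does; infima
are the negatives of suprema of negatives. -/

namespace LatGroupHom

variable {G H : Type*} [AddCommGroup G] [Lattice G] [AddCommGroup H] [Lattice H]

/-- An isomorphism of ordered groups, as a homomorphism of lattice-ordered groups. -/
def ofOrderAddIso (e : G ≃+o H) : LatGroupHom G H where
  __ := e.toAddEquiv.toAddMonoidHom
  map_sup' := map_sup e.toOrderIso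
  map_inf' := map_inf e.toOrderIso

variable [IsOrderedAddMonoid G] [IsOrderedAddMonoid H]

/-- An additive map that preserves `⊔`, as a homomorphism of lattice-ordered groups: it preserves
`⊓` because `x ⊓ y = -(-x ⊔ -y)`. -/
def ofMapSup (f : G →+ H) (hf : ∀ x y, f (x ⊔ y) = f x ⊔ f y) : LatGroupHom G H where
  __ := f
  map_sup' := hf
  map_inf' x y := by
    change f (x ⊓ y) = f x ⊓ f y
    have inf_eq : x ⊓ y = -(-x ⊔ -y) := by rw [neg_sup, neg_neg, neg_neg]
    rw [inf_eq, map_neg, hf, map_neg, map_neg, neg_sup, neg_neg, neg_neg]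

end LatGroupHom

/-- An isomorphism of ordered groups, as an isomorphism of abelian lattice-ordered groups. -/
def AbLatGroup.isoOfOrderAddIso {G H : AbLatGroup.{u}} (e : G ≃+o H) : G ≅ H where
  hom := LatGroupHom.ofOrderAddIso e
  inv := LatGroupHom.ofOrderAddIso e.symm
  hom_inv_id := LatGroupHom.ext (funext e.symm_apply_apply)
  inv_hom_id := LatGroupHom.ext (funext e.apply_symm_apply)

/-- An isomorphism of lattice-ordered monoids with top, as a morphism of `TOP`. -/
def ConeTopHom.ofOrderAddIso {S T : Type*} [AddCommMonoid S] [Lattice S] [OrderTop S]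
    [AddCommMonoid T] [Lattice T] [OrderTop T] (e : S ≃+o T) : ConeTopHom S T where
  __ := e.toAddEquiv.toAddMonoidHom
  map_sup' := map_sup e.toOrderIso
  map_inf' := map_inf e.toOrderIso
  map_cone' _ hx h := hx ((map_eq_top_iff e.toOrderIso).1 h)
  map_top' := map_top e.toOrderIso

/-- An isomorphism of lattice-ordered monoids with top, as an isomorphism of `TOP`. -/
def ConeTop.isoOfOrderAddIso {S T : ConeTop.{u}} (e : S ≃+o T) : S ≅ T where
  hom := ConeTopHom.ofOrderAddIso e
  inv := ConeTopHom.ofOrderAddIso e.symm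
  hom_inv_id := ConeTopHom.ext (funext e.symm_apply_apply)
  inv_hom_id := ConeTopHom.ext (funext e.apply_symm_apply)

namespace Detrop

variable {S T : IdemSemifield.{u}}

theorem map_injective : Function.Injective (map (S := S) (T := T)) := by
  intro f g h
  ext x
  obtain rfl | hx := eq_or_ne x 0
  · rw [map_zero, map_zero]
  · exact congrArg val (DFunLike.congr_fun h ⟨x, hx⟩)

open Classical in
/-- The extension by zero of a homomorphism between the groups of nonzero elements. -/
noncomputable def extend (f : LatGroupHom (Detrop S) (Detrop T)) : S →+* T where
  toFun x := if hx : x = 0 then 0 else (f ⟨x, hx⟩).val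
  map_zero' := dif_pos rfl
  map_one' := (dif_neg one_ne_zero).trans (congrArg val f.map_zero)
  map_mul' x y := by
    obtain rfl | hx := eq_or_ne x 0
    · simp
    obtain rfl | hy := eq_or_ne y 0
    · simp
    rw [dif_neg (mul_ne_zero hx hy), dif_neg hx, dif_neg hy]
    exact congrArg val (f.map_add ⟨x, hx⟩ ⟨y, hy⟩)
  map_add' x y := by
    obtain rfl | hx := eq_or_ne x 0
    · simp
    obtain rfl | hy := eq_or_ne y 0
    · simp
    rw [dif_neg (add_ne_zero S hx), dif_neg hx, dif_neg hy]
    exact congrArg val (f.map_sup ⟨x, hx⟩ ⟨y, hy⟩)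

theorem map_extend (f : LatGroupHom (Detrop S) (Detrop T)) : map (extend f) = f :=
  LatGroupHom.ext (funext fun x => Detrop.ext (dif_neg x.ne_zero))

end Detrop

/-- The semifield `G ∪ {0}` of an abelian lattice-ordered group `G`: the product is the sum of `G`
and the sum is the supremum, the adjoined zero being the least element. -/
def Trop (G : Type*) : Type _ := WithZero (Multiplicative G)

namespace Trop

variable {G : Type*}

instance [AddCommGroup G] : CommGroupWithZero (Trop G) :=
  inferInstanceAs (CommGroupWithZero (WithZero (Multiplicative G)))

instance [SemilatticeSup G] : SemilatticeSup (Trop G) :=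
  let : SemilatticeSup (Multiplicative G) := inferInstanceAs (SemilatticeSup G)
  inferInstanceAs (SemilatticeSup (WithZero (Multiplicative G)))

/-- The nonzero element of `G ∪ {0}` given by an element of `G`. -/
def of (g : G) : Trop G := ((Multiplicative.ofAdd g : Multiplicative G) : WithZero _)

theorem of_injective : Function.Injective (of (G := G)) :=
  WithZero.coe_injective.comp Multiplicative.ofAdd.injective

section Sup

variable [SemilatticeSup G]

instance : Add (Trop G) := ⟨(· ⊔ ·)⟩

theorem of_sup (g h : G) : of (g ⊔ h) = of g + of h := rfl

protected theorem add_comm (x y : Trop G) : x + y = y + x := sup_comm x y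

end Sup

variable [AddCommGroup G]

theorem of_add (g h : G) : of (g + h) = of g * of h := rfl

theorem of_ne_zero (g : G) : of g ≠ 0 := WithZero.coe_ne_zero

@[elab_as_elim]
theorem induction_on {p : Trop G → Prop} (x : Trop G) (zero : p 0) (of : ∀ g, p (of g)) : p x :=
  WithZero.recZeroCoe (motive := p) zero (fun a => of a.toAdd) x

theorem exists_of_eq {x : Trop G} (hx : x ≠ 0) : ∃ g, of g = x := by
  induction x using induction_on with
  | zero => exact absurd rfl hx
  | of g => exact ⟨g, rfl⟩

variable [SemilatticeSup G]

protected theorem zero_add (x : Trop G) : 0 + x = x := by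
  induction x using induction_on <;> rfl

protected theorem add_zero (x : Trop G) : x + 0 = x := by
  rw [Trop.add_comm, Trop.zero_add]

protected theorem mul_add [AddLeftMono G] (x y z : Trop G) :
    x * (y + z) = x * y + x * z := by
  induction x using induction_on with
  | zero => rw [zero_mul, zero_mul, zero_mul, Trop.zero_add]
  | of a =>
    induction y using induction_on with
    | zero => rw [mul_zero, Trop.zero_add, Trop.zero_add]
    | of b =>
      induction z using induction_on with
      | zero => rw [mul_zero, Trop.add_zero, Trop.add_zero]
      | of c =>
        rw [← of_sup, ← of_add, ← of_add, ← of_add, ← of_sup]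
        exact congrArg of ((OrderIso.addLeft a).map_sup b c)

noncomputable instance [AddLeftMono G] : Semifield (Trop G) where
  __ := (inferInstance : CommGroupWithZero (Trop G))
  zero_add := Trop.zero_add
  add_zero := Trop.add_zero
  add_comm := Trop.add_comm
  add_assoc := sup_assoc
  left_distrib := Trop.mul_add
  right_distrib x y z := by rw [mul_comm, Trop.mul_add, mul_comm z, mul_comm z]
  nsmul := nsmulRec
  nnqsmul := _
  nnqsmul_def _ _ := rfl

end Trop

/-- The additively idempotent semifield `G ∪ {0}`, as an object of the category. -/
noncomputable def IdemSemifield.ofGroup (G : AbLatGroup.{u}) : IdemSemifield.{u} where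
  carrier := Trop G
  add_self := sup_idem (α := Trop G)

namespace Trop

/-- The nonzero elements of `G ∪ {0}` are those of `G`. -/
noncomputable def detropIso (G : AbLatGroup.{u}) : G ≃+o Detrop (IdemSemifield.ofGroup G) where
  toEquiv := Equiv.ofBijective (fun g => ⟨of g, of_ne_zero g⟩)
    ⟨fun _ _ h => of_injective (congrArg Detrop.val h), fun x =>
      (exists_of_eq x.ne_zero).imp fun _ => Detrop.ext⟩
  map_add' _ _ := rfl
  map_le_map_iff' {g h} := by
    change of g + of h = of h ↔ g ≤ h
    rw [← of_sup, of_injective.eq_iff, sup_eq_right]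

end Trop

instance detropFunctor_faithful : detropFunctor.{u}.Faithful where
  map_injective {_ _} := Detrop.map_injective

instance detropFunctor_full : detropFunctor.{u}.Full where
  map_surjective f := ⟨Detrop.extend f, Detrop.map_extend f⟩

instance detropFunctor_essSurj : detropFunctor.{u}.EssSurj where
  mem_essImage G :=
    ⟨IdemSemifield.ofGroup G, ⟨(AbLatGroup.isoOfOrderAddIso (Trop.detropIso G)).symm⟩⟩

instance detropFunctor_isEquivalence : detropFunctor.{u}.IsEquivalence where

/-- The positive cone `G⁺` of a lattice-ordered group. -/
abbrev PosCone (G : Type*) [AddCommGroup G] [Lattice G] : Type _ := {g : G // 0 ≤ g}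

namespace PosCone

variable {G H : Type*} [AddCommGroup G] [Lattice G]

instance : Lattice (PosCone G) where
  __ := Nonneg.semilatticeSup
  __ := Nonneg.semilatticeInf

theorem coe_sup (a b : PosCone G) : ((a ⊔ b : PosCone G) : G) = ↑a ⊔ ↑b := rfl

variable [IsOrderedAddMonoid G]

theorem exists_add_eq_coe (x y : G) : ∃ a b c : PosCone G, x + c = a ∧ y + c = b := by
  have neg_le_left : -x ≤ x⁻ + y⁻ :=
    le_add_of_le_of_nonneg (neg_le_negPart x) (negPart_nonneg y)
  have neg_le_right : -y ≤ x⁻ + y⁻ :=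
    le_add_of_nonneg_of_le (negPart_nonneg x) (neg_le_negPart y)
  exact ⟨⟨_, neg_le_iff_add_nonneg'.1 neg_le_left⟩,
    ⟨_, neg_le_iff_add_nonneg'.1 neg_le_right⟩,
    ⟨_, add_nonneg (negPart_nonneg x) (negPart_nonneg y)⟩, rfl, rfl⟩

section Extend

variable [AddCommGroup H] (k : PosCone G →+ H)

theorem map_posPart_sub_map_negPart {x : G} {a b : PosCone G} (hx : x = a - b) :
    k ⟨x⁺, posPart_nonneg x⟩ - k ⟨x⁻, negPart_nonneg x⟩ = k a - k b := by
  rw [sub_eq_sub_iff_add_eq_add, ← map_add, ← map_add]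
  refine congrArg k (Subtype.ext ?_)
  change x⁺ + b = a + x⁻
  rw [← sub_eq_sub_iff_add_eq_add, posPart_sub_negPart, hx]

/-- The extension of an additive map from the positive cone to the whole group, by
`k (a - b) = k a - k b`. -/
def extend : G →+ H :=
  AddMonoidHom.mk' (fun x => k ⟨x⁺, posPart_nonneg x⟩ - k ⟨x⁻, negPart_nonneg x⟩) fun x y => by
    rw [← add_sub_add_comm, ← map_add, ← map_add]
    refine map_posPart_sub_map_negPart k ?_
    change x + y = x⁺ + y⁺ - (x⁻ + y⁻)
    rw [add_sub_add_comm, posPart_sub_negPart, posPart_sub_negPart]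

theorem extend_coe (a : PosCone G) : extend k a = k a := by
  have coe_eq : (a : G) = a - (0 : PosCone G) := (sub_zero _).symm
  exact (map_posPart_sub_map_negPart k coe_eq).trans (by rw [map_zero, sub_zero])

variable {k} [Lattice H] [IsOrderedAddMonoid H]

theorem extend_sup (hk : ∀ a b, k (a ⊔ b) = k a ⊔ k b) (x y : G) :
    extend k (x ⊔ y) = extend k x ⊔ extend k y := by
  obtain ⟨a, b, c, hxa, hyb⟩ := exists_add_eq_coe x y
  refine add_right_cancel (b := k c) ?_
  calc
    extend k (x ⊔ y) + k c = extend k ↑(a ⊔ b) := by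
      rw [← extend_coe, ← map_add, sup_add, hxa, hyb, coe_sup]
    _ = k a ⊔ k b := by rw [extend_coe, hk]
    _ = (extend k x ⊔ extend k y) + k c := by
      rw [sup_add, ← extend_coe k c, ← map_add, ← map_add, hxa, hyb, extend_coe, extend_coe]

end Extend

end PosCone

namespace LatGroupHom

variable {G H : Type*} [AddCommGroup G] [Lattice G] [IsOrderedAddMonoid G]
  [AddCommGroup H] [Lattice H]

theorem ext_posCone {f g : LatGroupHom G H} (h : ∀ a : PosCone G, f a = g a) : f = g := by
  refine LatGroupHom.ext (funext fun x => ?_)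
  change f x = g x
  rw [← posPart_sub_negPart x, f.map_sub, g.map_sub, h ⟨_, posPart_nonneg x⟩,
    h ⟨_, negPart_nonneg x⟩]

variable [IsOrderedAddMonoid H]

/-- The restriction of a homomorphism to the positive cones. -/
def posCone (f : LatGroupHom G H) : PosCone G →+ PosCone H where
  toFun a := ⟨f a, f.map_zero.symm.trans_le (f.monotone a.2)⟩
  map_zero' := Subtype.ext f.map_zero
  map_add' a b := Subtype.ext (f.map_add a b)

/-- The extension to the whole groups of a map of positive cones that preserves `+` and `⊔`. -/
def ofPosCone (k : PosCone G →+ PosCone H) (hk : ∀ a b, k (a ⊔ b) = k a ⊔ k b) :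
    LatGroupHom G H :=
  ofMapSup (PosCone.extend (Nonneg.coeAddMonoidHom.comp k)) <|
    PosCone.extend_sup fun a b => congrArg Subtype.val (hk a b)

theorem posCone_ofPosCone (k : PosCone G →+ PosCone H) (hk : ∀ a b, k (a ⊔ b) = k a ⊔ k b) :
    (ofPosCone k hk).posCone = k :=
  DFunLike.ext _ _ fun a => Subtype.ext (PosCone.extend_coe _ a)

end LatGroupHom

namespace ConeTopHom

variable {P Q : Type*} [AddCommMonoid P] [Lattice P] [AddCommMonoid Q] [Lattice Q]

theorem ext_coe {T : Type*} [AddCommMonoid T] [Lattice T] [OrderTop T]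
    {φ ψ : ConeTopHom (WithTop P) T} (h : ∀ a : P, φ a = ψ a) : φ = ψ := by
  refine ConeTopHom.ext (funext fun x => ?_)
  induction x with
  | top => exact φ.map_top'.trans ψ.map_top'.symm
  | coe a => exact h a

/-- The extension of a map preserving `+`, `⊔` and `⊓` that sends `⊤` to `⊤`. -/
def withTop (f : P →+ Q) (hsup : ∀ a b, f (a ⊔ b) = f a ⊔ f b)
    (hinf : ∀ a b, f (a ⊓ b) = f a ⊓ f b) : ConeTopHom (WithTop P) (WithTop Q) where
  __ := f.withTopMap
  map_sup' := map_sup (LatticeHom.withTop ⟨⟨f, hsup⟩, hinf⟩)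
  map_inf' := map_inf (LatticeHom.withTop ⟨⟨f, hsup⟩, hinf⟩)
  map_cone' _ := WithTop.map_eq_top_iff.not.2
  map_top' := rfl

/-- The restriction of a morphism of `TOP` to the elements other than `⊤`. -/
def untop (φ : ConeTopHom (WithTop P) (WithTop Q)) : P →+ Q where
  toFun a := (φ a).untop (φ.map_cone' a WithTop.coe_ne_top)
  map_zero' := (WithTop.untop_eq_iff _).2 φ.map_zero'
  map_add' a b := (WithTop.untop_eq_iff _).2 (by
    rw [WithTop.coe_add, WithTop.coe_add, WithTop.coe_untop, WithTop.coe_untop]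
    exact φ.map_add' a b)

theorem coe_untop (φ : ConeTopHom (WithTop P) (WithTop Q)) (a : P) :
    (φ.untop a : WithTop Q) = φ a :=
  WithTop.coe_untop _ _

theorem untop_sup (φ : ConeTopHom (WithTop P) (WithTop Q)) (a b : P) :
    φ.untop (a ⊔ b) = φ.untop a ⊔ φ.untop b := by
  rw [← WithTop.coe_inj, WithTop.coe_sup, coe_untop, coe_untop, coe_untop, WithTop.coe_sup]
  exact φ.map_sup' a b

end ConeTopHom

namespace LatGroupHom

variable {G H : Type*} [AddCommGroup G] [Lattice G] [IsOrderedAddMonoid G]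
  [AddCommGroup H] [Lattice H] [IsOrderedAddMonoid H]

/-- The map `G⁺ ∪ {⊤} → H⁺ ∪ {⊤}` induced by a homomorphism `G → H`. -/
def posConeTop (f : LatGroupHom G H) : ConeTopHom (WithTop (PosCone G)) (WithTop (PosCone H)) :=
  ConeTopHom.withTop f.posCone (fun a b => Subtype.ext (f.map_sup a b))
    fun a b => Subtype.ext (f.map_inf a b)

theorem posConeTop_injective : Function.Injective (posConeTop (G := G) (H := H)) :=
  fun f g h => ext_posCone fun a =>
    have coe_eq : (f.posCone a : WithTop (PosCone H)) = g.posCone a := DFunLike.congr_fun h ↑a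
    congrArg Subtype.val (WithTop.coe_injective coe_eq)

theorem posConeTop_surjective : Function.Surjective (posConeTop (G := G) (H := H)) := fun φ => by
  refine ⟨ofPosCone φ.untop φ.untop_sup, ConeTopHom.ext_coe fun a => ?_⟩
  change ((ofPosCone φ.untop φ.untop_sup).posCone a : WithTop (PosCone H)) = φ a
  rw [posCone_ofPosCone, φ.coe_untop]

end LatGroupHom

/-- The functor `G ↦ G⁺ ∪ {⊤}` from abelian lattice-ordered groups to `TOP`. -/
def posConeTopFunctor : AbLatGroup.{u} ⥤ ConeTop.{u} where
  obj G := { carrier := WithTop (PosCone G), isCone := ⟨G, ⟨OrderAddMonoidIso.refl _⟩⟩ }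
  map f := LatGroupHom.posConeTop f
  map_id _ := ConeTopHom.ext_coe fun _ => rfl
  map_comp _ _ := ConeTopHom.ext_coe fun _ => rfl

instance posConeTopFunctor_faithful : posConeTopFunctor.{u}.Faithful where
  map_injective {_ _} := LatGroupHom.posConeTop_injective

instance posConeTopFunctor_full : posConeTopFunctor.{u}.Full where
  map_surjective {_ _} := LatGroupHom.posConeTop_surjective

instance posConeTopFunctor_essSurj : posConeTopFunctor.{u}.EssSurj where
  mem_essImage T :=
    let ⟨G, ⟨e⟩⟩ := T.isCone
    ⟨G, ⟨(ConeTop.isoOfOrderAddIso (T := posConeTopFunctor.obj G) e).symm⟩⟩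

instance posConeTopFunctor_isEquivalence : posConeTopFunctor.{u}.IsEquivalence where

namespace Delta

open MVAlgebra

variable {G : Type u} [AddCommGroup G] [Lattice G] [IsOrderedAddMonoid G]

/-- The element `(0, g)` of `Δ(G)`. -/
def ofPosCone (g : PosCone G) : Delta G where
  val := toLex (0, g)
  nonneg := LexInt.le_iff.2 (Or.inr ⟨rfl, g.2⟩)
  le := LexInt.le_iff.2 (Or.inl one_pos)

theorem isInfinitesimal_ofPosCone (g : PosCone G) : IsInfinitesimal (ofPosCone g) :=
  (isInfinitesimal_iff _).2 rfl

theorem ofPosCone_add (g h : PosCone G) : ofPosCone (g + h) = ofPosCone g + ofPosCone h :=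
  Gamma.ext (inf_eq_left.2 (ofPosCone (g + h)).le).symm

theorem ofPosCone_le_ofPosCone {g h : PosCone G} : ofPosCone g ≤ ofPosCone h ↔ g ≤ h := by
  rw [Gamma.le_iff_val, LexInt.le_iff]
  exact (or_iff_right (lt_irrefl 0)).trans (and_iff_right rfl)

theorem ofPosCone_injective : Function.Injective (ofPosCone (G := G)) := fun _ _ h =>
  Subtype.ext (congrArg (fun x : Delta G => (ofLex x.val).2) h)

theorem exists_ofPosCone_eq {x : Delta G} (hx : IsInfinitesimal x) : ∃ g, ofPosCone g = x := by
  have fst_eq_zero : (ofLex x.val).1 = 0 := (isInfinitesimal_iff x).1 hx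
  have snd_nonneg : 0 ≤ (ofLex x.val).2 := by
    obtain fst_pos | ⟨-, h⟩ := LexInt.le_iff.1 x.nonneg
    · exact absurd fst_eq_zero fst_pos.ne'
    · exact h
  exact ⟨⟨_, snd_nonneg⟩, Gamma.ext (congrArg toLex (Prod.ext fst_eq_zero.symm rfl))⟩

/-- The positive cone of `G` is that of `θ(Δ(G))`, through `g ↦ (0, g)`. -/
noncomputable def posConeIso : PosCone G ≃o {x : Theta (Delta G) // x ≠ ⊤} where
  toEquiv := Equiv.ofBijective
    (fun g => ⟨⟨ofPosCone g, (isInfinitesimal_ofPosCone g).inTheta⟩,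
      Theta.ne_top_iff.2 (isInfinitesimal_ofPosCone g)⟩)
    ⟨fun _ _ h => ofPosCone_injective (congrArg (fun x => x.1.1) h), fun x =>
      (exists_ofPosCone_eq (Theta.ne_top_iff.1 x.2)).imp fun _ h => Subtype.ext (Subtype.ext h)⟩
  map_rel_iff' := ofPosCone_le_ofPosCone

open Classical in
/-- The bijection of `G⁺ ∪ {⊤}` with `θ(Δ(G))`, which sends `g` to `(0, g)` and `⊤` to `(1, 0)`. -/
noncomputable def posConeTopOrderIso : WithTop (PosCone G) ≃o Theta (Delta G) :=
  posConeIso.withTopCongr.trans WithTop.subtypeOrderIso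

theorem posConeTopOrderIso_add (x y : WithTop (PosCone G)) :
    posConeTopOrderIso (x + y) = posConeTopOrderIso x + posConeTopOrderIso y := by
  have add_top (z : Theta (Delta G)) : z + ⊤ = ⊤ := Subtype.ext (add_one' z.1)
  induction y with
  | top => rw [WithTop.add_top, map_top, add_top]
  | coe b =>
    induction x with
    | top => rw [WithTop.top_add, map_top, add_comm, add_top]
    | coe a => exact Subtype.ext (ofPosCone_add a b)

/-- `posConeTopOrderIso` as an isomorphism of ordered monoids. -/
noncomputable def posConeTopIso : WithTop (PosCone G) ≃+o Theta (Delta G) where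
  __ := posConeTopOrderIso
  map_add' := posConeTopOrderIso_add
  map_le_map_iff' := posConeTopOrderIso.map_rel_iff

end Delta

/-- The natural isomorphism `G⁺ ∪ {⊤} ≅ θ(Δ(G))`. -/
noncomputable def posConeTopFunctorIso :
    posConeTopFunctor.{u} ≅ deltaFunctor.{u} ⋙ thetaFunctor.{u} :=
  NatIso.ofComponents (fun G => ConeTop.isoOfOrderAddIso (S := posConeTopFunctor.obj G)
      (T := (deltaFunctor ⋙ thetaFunctor).obj G) Delta.posConeTopIso)
    fun _ => ConeTopHom.ext_coe fun _ => rfl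

theorem mainTheorem3 :
    (detropFunctor.{u} ⋙ deltaFunctor.{u} ⋙ thetaFunctor.{u}).IsEquivalence := by
  have : (deltaFunctor.{u} ⋙ thetaFunctor.{u}).IsEquivalence :=
    Functor.isEquivalence_of_iso posConeTopFunctorIso
  infer_instance
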